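/- Let $\mathcal H$ be a separable complex Hilbert space, let $\mathcal B(\mathcal H)$ be the bounded operators on it, $\mathcal B^1(\mathcal H)$ the trace class, and $\mathcal B^2(\mathcal H)$ the Hilbert space of Hilbert–Schmidt operators with inner product $\langle X,Y\rangle=\operatorname{tr}(X^*Y)$. A linear map $\Phi:\mathcal B^1(\mathcal H)\to\mathcal B^1(\mathcal H)$ is completely positive if for every $n\in\mathbb N$ the map $(A_{jk})_{j,k=1}^n\mapsto(\Phi(A_{jk}))_{j,k=1}^n$ sends every positive semi-definite operator on $\mathbb C^n\otimes\mathcal H$ with entries $A_{jk}\in\mathcal B^1(\mathcal H)$ to a positive semi-definite operator. For $B\in\mathcal B^1(\mathcal H)$ let $\mathsf{CP}_B(\mathcal H)$ be the set of all completely positive linear maps $\Phi:\mathcal B^1(\mathcal H)\to\mathcal B^1(\mathcal H)$ such that the trace-class operator $X\mapsto\Phi(B^*XB)$ on the Hilbert space $\mathcal B^2(\mathcal H)$ has trace $0$. Let $K\in\mathcal B(\mathcal H)$ and let $B\in\mathcal B^1(\mathcal H)$ with $\operatorname{tr}(B)\neq0$. If there are $\Phi_1,\Phi_2\in\mathsf{CP}_B(\mathcal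 H)$ such that $KA+AK^*=\Phi_1(A)-\Phi_2(A)$ for all $A\in\mathcal B^1(\mathcal H)$, then $K=i\lambda\mathbf 1$ for some $\lambda\in\mathbb R$. -/

import Mathlib

noncomputable section

namespace QDyn


open scoped InnerProductSpace

/-! ### Orthonormal bases and the trace -/

section Trace

variable (E : Type*) [NormedAddCommGroup E] [InnerProductSpace ℂ E] [CompleteSpace E]

/-- Index set of the orthonormal basis `onb E`. -/
def onbIndex : Set E := Classical.choose (exists_hilbertBasis ℂ E)

/-- Some orthonormal basis of the Hilbert space `E`. -/
def onb : HilbertBasis (onbIndex E) ℂ E :=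
  Classical.choose (Classical.choose_spec (exists_hilbertBasis ℂ E))

variable {E}

/-- The trace `∑ⱼ ⟨gⱼ, T gⱼ⟩` over an orthonormal basis of `E`. For trace-class `T` the family is
absolutely summable and the sum does not depend on the basis. -/
def trace (T : E →ₗ[ℂ] E) : ℂ := ∑' j, ⟪onb E j, T (onb E j)⟫_ℂ

end Trace

variable {H : Type*} [NormedAddCommGroup H] [InnerProductSpace ℂ H] [CompleteSpace H]

/-! ### The trace class -/

/-- `A` is trace class: it has a Schmidt decomposition `A = ∑ⱼ sⱼ |fⱼ⟩⟨gⱼ|` with orthonormal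
systems `f`, `g`, indexed by some `N ⊆ ℕ`, and with summable singular values `sⱼ > 0`. -/
def IsTraceClass (A : H →L[ℂ] H) : Prop :=
  ∃ (N : Set ℕ) (s : N → ℝ) (f g : N → H),
    (∀ j, 0 < s j) ∧ Orthonormal ℂ f ∧ Orthonormal ℂ g ∧ Summable s ∧
      ∀ x, HasSum (fun j => ((s j : ℂ) * ⟪g j, x⟫_ℂ) • f j) (A x)

/-- `A = ∑ₙ |xₙ⟩⟨yₙ|` with `∑ₙ ‖xₙ‖ ‖yₙ‖ < ∞`. Auxiliary: it is equivalent to `IsTraceClass`, which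
is how the trace class is seen to be a two-sided ideal. -/
def HasNuclearSum {ι : Type*} (A : H →L[ℂ] H) (x y : ι → H) : Prop :=
  Summable (fun n => ‖x n‖ * ‖y n‖) ∧ ∀ z, HasSum (fun n => ⟪y n, z⟫_ℂ • x n) (A z)

lemma IsTraceClass.exists_nuclear {A : H →L[ℂ] H} (hA : IsTraceClass A) :
    ∃ (N : Set ℕ) (x y : N → H), HasNuclearSum A x y := by
  obtain ⟨N, s, f, g, hs, hf, hg, hsum, h⟩ := hA
  refine ⟨N, fun j => (s j : ℂ) • f j, g, ?_, fun z => ?_⟩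
  · convert hsum using 2 with j
    simp [norm_smul, hf.1, hg.1, abs_of_pos (hs j)]
  · convert h z using 2 with j
    rw [smul_smul, mul_comm]

/-- Orthonormal systems see a nuclear operator through an absolutely summable family. -/
lemma HasNuclearSum.summable_inner {ι κ : Type*} {A : H →L[ℂ] H} {x y : ι → H}
    (h : HasNuclearSum A x y) {e f : κ → H} (he : Orthonormal ℂ e) (hf : Orthonormal ℂ f) :
    Summable (fun k => ‖⟪e k, A (f k)⟫_ℂ‖) := by
  refine summable_of_sum_le (c := ∑' n, ‖x n‖ * ‖y n‖) (fun _ => norm_nonneg _) fun F => ?_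
  have key : ∀ k n, ‖⟪e k, ⟪y n, f k⟫_ℂ • x n⟫_ℂ‖ ≤ ‖x n‖ * ‖y n‖ := fun k n => by
    rw [inner_smul_right, norm_mul, mul_comm]
    have h1 := norm_inner_le_norm (𝕜 := ℂ) (e k) (x n)
    have h2 := norm_inner_le_norm (𝕜 := ℂ) (y n) (f k)
    rw [he.1, one_mul] at h1
    rw [hf.1, mul_one] at h2
    gcongr
  have hsm : ∀ k, Summable fun n => ‖⟪e k, ⟪y n, f k⟫_ℂ • x n⟫_ℂ‖ := fun k =>
    Summable.of_nonneg_of_le (fun _ => norm_nonneg _) (key k) h.1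
  calc ∑ k ∈ F, ‖⟪e k, A (f k)⟫_ℂ‖
      ≤ ∑ k ∈ F, ∑' n, ‖⟪e k, ⟪y n, f k⟫_ℂ • x n⟫_ℂ‖ := by
        refine Finset.sum_le_sum fun k _ => ?_
        have := (innerSL ℂ (e k)).hasSum (h.2 (f k))
        simp only [innerSL_apply_apply] at this
        rw [← this.tsum_eq]
        exact norm_tsum_le_tsum_norm (hsm k)
    _ = ∑' n, ∑ k ∈ F, ‖⟪e k, ⟪y n, f k⟫_ℂ • x n⟫_ℂ‖ :=
        (Summable.tsum_finsetSum fun k _ => hsm k).symm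
    _ ≤ ∑' n, ‖x n‖ * ‖y n‖ := by
        refine Summable.tsum_le_tsum (fun n => ?_) (summable_sum fun k _ => hsm k) h.1
        have h1 := he.sum_inner_products_le (x n) (s := F)
        have h2 := hf.sum_inner_products_le (y n) (s := F)
        calc ∑ k ∈ F, ‖⟪e k, ⟪y n, f k⟫_ℂ • x n⟫_ℂ‖
            = ∑ k ∈ F, ‖⟪e k, x n⟫_ℂ‖ * ‖⟪f k, y n⟫_ℂ‖ := by
              refine Finset.sum_congr rfl fun k _ => ?_
              rw [inner_smul_right, norm_mul, mul_comm, norm_inner_symm (y n)]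
          _ ≤ √(∑ k ∈ F, ‖⟪e k, x n⟫_ℂ‖ ^ 2) * √(∑ k ∈ F, ‖⟪f k, y n⟫_ℂ‖ ^ 2) :=
              Real.sum_mul_le_sqrt_mul_sqrt _ _ _
          _ ≤ ‖x n‖ * ‖y n‖ := by
              gcongr
              · exact Real.sqrt_le_iff.2 ⟨norm_nonneg _, h1⟩
              · exact Real.sqrt_le_iff.2 ⟨norm_nonneg _, h2⟩

lemma HasNuclearSum.isCompactOperator {ι : Type*} {A : H →L[ℂ] H} {x y : ι → H}
    (h : HasNuclearSum A x y) : IsCompactOperator A := by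
  have hsum : Summable fun n => InnerProductSpace.rankOne ℂ (x n) (y n) :=
    Summable.of_norm (by simpa using h.1)
  obtain ⟨T, hT⟩ := hsum
  have hTA : T = A := by
    ext z
    exact HasSum.unique ((ContinuousLinearMap.apply ℂ H z).hasSum hT) (h.2 z)
  subst hTA
  refine isCompactOperator_of_tendsto hT (Filter.Eventually.of_forall fun F => ?_)
  refine Submodule.sum_mem (compactOperator (RingHom.id ℂ) H H) fun n _ => ?_
  have : IsCompactOperator (ContinuousLinearMap.toSpanSingleton ℂ (x n) : ℂ →L[ℂ] H) := by
    have h1 : IsCompactOperator (id : ℂ → ℂ) :=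
      (isCompactOperator_id_iff_finiteDimensional (𝕜 := ℂ)).2 inferInstance
    exact h1.clm_comp (ContinuousLinearMap.toSpanSingleton ℂ (x n))
  exact this.comp_clm (innerSL ℂ (y n))

/-- A compact operator maps some orthonormal basis to an orthogonal family. -/
lemma exists_hilbertBasis_orthogonal_image {A : H →L[ℂ] H} (hA : IsCompactOperator A) :
    ∃ (w : Set H) (b : HilbertBasis w ℂ H), ∀ i j, i ≠ j → ⟪A (b i), A (b j)⟫_ℂ = 0 := by
  set T : H →L[ℂ] H := ContinuousLinearMap.adjoint A ∘L A with hTdef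
  have hTc : IsCompactOperator T := hA.clm_comp (ContinuousLinearMap.adjoint A)
  have hTs : (T : H →ₗ[ℂ] H).IsSymmetric := fun x y => by
    simp [hTdef, ContinuousLinearMap.adjoint_inner_left, ContinuousLinearMap.adjoint_inner_right]
  have hcl : ∀ μ : ℂ, CompleteSpace (Module.End.eigenspace (T : H →ₗ[ℂ] H) μ) := fun μ => by
    have : IsClosed (Module.End.eigenspace (T : H →ₗ[ℂ] H) μ : Set H) := by
      have : (Module.End.eigenspace (T : H →ₗ[ℂ] H) μ : Set H) = {x | T x = μ • x} := by
        ext x; simp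
      rw [this]
      exact isClosed_eq T.continuous (continuous_const_smul μ)
    exact this.completeSpace_coe
  choose w v hv using fun μ : ℂ =>
    exists_hilbertBasis ℂ (Module.End.eigenspace (T : H →ₗ[ℂ] H) μ)
  have hon := hTs.orthogonalFamily_eigenspaces.orthonormal_sigma_orthonormal
    fun μ => (v μ).orthonormal
  set e : (Σ μ : ℂ, w μ) → H := fun a => (v a.1 a.2 : H) with he
  have hon' : Orthonormal ℂ e := hon
  have hperp : (Submodule.span ℂ (Set.range ((↑) : Set.range e → H)))ᗮ = ⊥ := by
    rw [Subtype.range_coe, eq_bot_iff,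
      ← ContinuousLinearMap.orthogonalComplement_iSup_eigenspaces_eq_bot hTc hTs]
    intro z hz
    rw [Submodule.mem_orthogonal] at hz
    rw [Submodule.mem_orthogonal']
    intro u hu
    refine Submodule.iSup_induction _ (motive := fun u => ⟪z, u⟫_ℂ = 0) hu ?_ (by simp) ?_
    · intro μ u hu
      have h1 := (v μ).hasSum_repr ⟨u, hu⟩
      have h2 := (innerSL ℂ z).hasSum
        ((Module.End.eigenspace (T : H →ₗ[ℂ] H) μ).subtypeL.hasSum h1)
      have h3 : ∀ i, innerSL ℂ z ((Module.End.eigenspace (T : H →ₗ[ℂ] H) μ).subtypeL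
          ((v μ).repr ⟨u, hu⟩ i • v μ i)) = 0 := fun i => by
        have := hz _ (Submodule.subset_span ⟨⟨μ, i⟩, rfl⟩)
        rw [inner_eq_zero_symm] at this
        simp only [Submodule.subtypeL_apply, Submodule.coe_smul, innerSL_apply_apply, inner_smul_right]
        exact mul_eq_zero_of_right _ this
      simp only [h3] at h2
      exact h2.unique hasSum_zero
    · intro a c ha hc
      simp [ha, hc]
  refine ⟨Set.range e, HilbertBasis.mkOfOrthogonalEqBot hon'.toSubtypeRange hperp, ?_⟩
  rintro ⟨_, i, rfl⟩ ⟨_, j, rfl⟩ hij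
  have hij' : i ≠ j := fun h => hij (by subst h; rfl)
  simp only [HilbertBasis.coe_mkOfOrthogonalEqBot]
  have hTj : T (e j) = j.1 • e j :=
    Module.End.mem_eigenspace_iff.1 (v j.1 j.2).2
  rw [← ContinuousLinearMap.adjoint_inner_right]
  change ⟪e i, T (e j)⟫_ℂ = 0
  rw [hTj, inner_smul_right, hon'.2 hij', mul_zero]

lemma HasNuclearSum.isTraceClass {ι : Type*} {A : H →L[ℂ] H} {x y : ι → H}
    (h : HasNuclearSum A x y) : IsTraceClass A := by
  obtain ⟨w, b, hb⟩ := exists_hilbertBasis_orthogonal_image h.isCompactOperator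
  let J : Type _ := {i : w // A (b i) ≠ 0}
  let s : J → ℝ := fun i => ‖A (b i.1)‖
  have hs : ∀ i, 0 < s i := fun i => norm_pos_iff.2 i.2
  let f : J → H := fun i => (s i : ℂ)⁻¹ • A (b i.1)
  let g : J → H := fun i => b i.1
  have hsf : ∀ i, (s i : ℂ) • f i = A (b i.1) := fun i => by
    have : (s i : ℂ) ≠ 0 := by exact_mod_cast (hs i).ne'
    simp [f, smul_smul, this]
  have hg : Orthonormal ℂ g := b.orthonormal.comp _ Subtype.val_injective
  have hf : Orthonormal ℂ f := by
    constructor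
    · intro i
      simp only [f, norm_smul, norm_inv, Complex.norm_real, Real.norm_eq_abs, abs_of_pos (hs i)]
      exact inv_mul_cancel₀ (hs i).ne'
    · intro i j hij
      simp [f, inner_smul_left, inner_smul_right, hb _ _ (fun h => hij (Subtype.ext h))]
  have hsum : Summable s := by
    have := h.summable_inner hf hg
    refine this.congr fun i => ?_
    simp only [f, g, inner_smul_left, inner_self_eq_norm_sq_to_K]
    have := hs i
    simp only [norm_mul, map_inv₀, Complex.conj_ofReal, norm_inv, Complex.norm_real, norm_pow,
      Real.norm_eq_abs, abs_of_pos (hs i)]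
    change _ * (‖((s i : ℝ) : ℂ)‖) ^ 2 = _
    simp only [Complex.norm_real, Real.norm_eq_abs, abs_of_pos (hs i)]
    field_simp
  have hcount : Countable J := by
    have := hsum.countable_support
    rw [show Function.support s = Set.univ from
      Set.eq_univ_of_forall fun i => (hs i).ne'] at this
    exact Set.countable_univ_iff.1 this
  obtain ⟨φ, hφ⟩ := exists_injective_nat J
  let e : J ≃ Set.range φ := Equiv.ofInjective φ hφ
  refine ⟨Set.range φ, s ∘ e.symm, f ∘ e.symm, g ∘ e.symm, fun j => hs _,
    hf.comp _ e.symm.injective, hg.comp _ e.symm.injective,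
    (Equiv.summable_iff e.symm).2 hsum, fun z => ?_⟩
  have h1 : HasSum (fun i => ⟪b i, z⟫_ℂ • A (b i)) (A z) := by
    have := A.hasSum (b.hasSum_repr z)
    simpa [HilbertBasis.repr_apply_apply] using this
  have h2 : HasSum (fun i : J => ⟪b i.1, z⟫_ℂ • A (b i.1)) (A z) := by
    refine (hasSum_subtype_iff_of_support_subset (s := {i | A (b i) ≠ 0}) ?_).2 h1
    intro i hi
    simp only [Function.mem_support] at hi
    exact fun h0 => hi (by simp [h0])
  refine (Equiv.hasSum_iff (f := fun i : J => ((s i : ℂ) * ⟪g i, z⟫_ℂ) • f i) e.symm).2 ?_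
  convert h2 using 2 with i
  rw [mul_comm, ← smul_smul, hsf i]

lemma HasNuclearSum.clm_comp {ι : Type*} {A : H →L[ℂ] H} {x y : ι → H}
    (h : HasNuclearSum A x y) (K : H →L[ℂ] H) :
    HasNuclearSum (K ∘L A) (fun n => K (x n)) y := by
  refine ⟨Summable.of_nonneg_of_le (fun n => by positivity) (fun n => ?_) (h.1.mul_left ‖K‖),
    fun z => ?_⟩
  · rw [← mul_assoc]
    gcongr
    exact K.le_opNorm _
  · simpa using K.hasSum (h.2 z)

lemma HasNuclearSum.comp_clm {ι : Type*} {A : H →L[ℂ] H} {x y : ι → H}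
    (h : HasNuclearSum A x y) (K : H →L[ℂ] H) :
    HasNuclearSum (A ∘L K) x (fun n => ContinuousLinearMap.adjoint K (y n)) := by
  refine ⟨Summable.of_nonneg_of_le (fun n => by positivity) (fun n => ?_)
    (h.1.mul_left ‖ContinuousLinearMap.adjoint K‖), fun z => ?_⟩
  · rw [mul_left_comm]
    gcongr
    exact ContinuousLinearMap.le_opNorm _ _
  · simpa [ContinuousLinearMap.adjoint_inner_left] using h.2 (K z)

lemma IsTraceClass.clm_comp {A : H →L[ℂ] H} (hA : IsTraceClass A) (K : H →L[ℂ] H) :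
    IsTraceClass (K ∘L A) :=
  let ⟨_, _, _, h⟩ := hA.exists_nuclear
  (h.clm_comp K).isTraceClass

lemma IsTraceClass.comp_clm {A : H →L[ℂ] H} (hA : IsTraceClass A) (K : H →L[ℂ] H) :
    IsTraceClass (A ∘L K) :=
  let ⟨_, _, _, h⟩ := hA.exists_nuclear
  (h.comp_clm K).isTraceClass

lemma IsTraceClass.zero : IsTraceClass (0 : H →L[ℂ] H) :=
  HasNuclearSum.isTraceClass (ι := Empty) (x := Empty.elim) (y := Empty.elim)
    ⟨summable_empty, fun _ => hasSum_empty⟩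

lemma IsTraceClass.add {A C : H →L[ℂ] H} (hA : IsTraceClass A) (hC : IsTraceClass C) :
    IsTraceClass (A + C) := by
  obtain ⟨N, x, y, h⟩ := hA.exists_nuclear
  obtain ⟨M, x', y', h'⟩ := hC.exists_nuclear
  refine HasNuclearSum.isTraceClass (ι := N ⊕ M) (x := Sum.elim x x') (y := Sum.elim y y')
    ⟨Summable.sum _ h.1 h'.1, fun z => ?_⟩
  exact HasSum.sum (h.2 z) (h'.2 z)

variable (H) in
/-- The trace class `𝓑¹(H)`. -/
def TraceClass : Submodule ℂ (H →L[ℂ] H) where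
  carrier := {A | IsTraceClass A}
  zero_mem' := IsTraceClass.zero
  add_mem' := IsTraceClass.add
  smul_mem' c A hA := by
    have := IsTraceClass.clm_comp hA (c • ContinuousLinearMap.id ℂ H)
    simpa using this

/-! ### The Hilbert space of Hilbert-Schmidt operators -/

/-- `A` is Hilbert-Schmidt: `∑ⱼ ‖A gⱼ‖² < ∞` for an orthonormal basis `g`. -/
def IsHilbertSchmidt (A : H →L[ℂ] H) : Prop := Summable fun j => ‖A (onb H j)‖ ^ 2

lemma isHilbertSchmidt_iff_memℓp {A : H →L[ℂ] H} :
    IsHilbertSchmidt A ↔ Memℓp (fun j => A (onb H j)) 2 := by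
  rw [memℓp_gen_iff (by simp)]
  simp [IsHilbertSchmidt]

lemma IsTraceClass.isHilbertSchmidt {A : H →L[ℂ] H} (hA : IsTraceClass A) :
    IsHilbertSchmidt A := by
  obtain ⟨_, _, _, h⟩ := hA.exists_nuclear
  have := (h.clm_comp (ContinuousLinearMap.adjoint A)).summable_inner
    (onb H).orthonormal (onb H).orthonormal
  refine this.congr fun j => ?_
  simp [ContinuousLinearMap.adjoint_inner_right]

variable (H) in
/-- The Hilbert-Schmidt operators as a subspace of `𝓑(H)`. -/
def hilbertSchmidtSubmodule : Submodule ℂ (H →L[ℂ] H) where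
  carrier := {A | IsHilbertSchmidt A}
  zero_mem' := by simp [IsHilbertSchmidt, summable_zero]
  add_mem' {A C} hA hC := by
    have := (isHilbertSchmidt_iff_memℓp.1 hA).add (isHilbertSchmidt_iff_memℓp.1 hC)
    exact isHilbertSchmidt_iff_memℓp.2 this
  smul_mem' c A hA := by
    have := (isHilbertSchmidt_iff_memℓp.1 hA).const_smul c
    exact isHilbertSchmidt_iff_memℓp.2 this

variable (H) in
/-- The Hilbert-Schmidt class `𝓑²(H)`; it carries the Hilbert-Schmidt inner product
`⟨X, Y⟩ = tr(X* Y)` and the norm that comes from it, not the operator norm. -/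
def HilbertSchmidt : Type _ := hilbertSchmidtSubmodule H

namespace HilbertSchmidt

instance : AddCommGroup (HilbertSchmidt H) :=
  inferInstanceAs (AddCommGroup (hilbertSchmidtSubmodule H))

instance : Module ℂ (HilbertSchmidt H) :=
  inferInstanceAs (Module ℂ (hilbertSchmidtSubmodule H))

variable (H) in
/-- The inclusion `𝓑²(H) ⊆ 𝓑(H)`. -/
def toCLM : HilbertSchmidt H →ₗ[ℂ] (H →L[ℂ] H) := (hilbertSchmidtSubmodule H).subtype

lemma toCLM_injective : Function.Injective (toCLM H) :=
  (hilbertSchmidtSubmodule H).injective_subtype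

lemma isHilbertSchmidt_toCLM (X : HilbertSchmidt H) : IsHilbertSchmidt (toCLM H X) := X.2

variable (H) in
/-- The map `X ↦ (X gⱼ)ⱼ` to the `ℓ²`-space of families in `H`. -/
def toLp : HilbertSchmidt H →ₗ[ℂ] lp (fun _ : onbIndex H => H) 2 where
  toFun X := ⟨fun j => toCLM H X (onb H j),
    isHilbertSchmidt_iff_memℓp.1 (isHilbertSchmidt_toCLM X)⟩
  map_add' _ _ := rfl
  map_smul' _ _ := rfl

lemma toLp_injective : Function.Injective (toLp H) := by
  intro X Y h
  apply toCLM_injective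
  have h' : ∀ j, toCLM H X (onb H j) = toCLM H Y (onb H j) := fun j =>
    congrFun (congrArg Subtype.val h) j
  ext z
  have h1 := (toCLM H X).hasSum ((onb H).hasSum_repr z)
  have h2 := (toCLM H Y).hasSum ((onb H).hasSum_repr z)
  simp only [map_smul, h'] at h1 h2
  exact h1.unique h2

/-- The Hilbert-Schmidt inner product `tr(X* Y)`. -/
def hsInner (X Y : HilbertSchmidt H) : ℂ :=
  trace ((ContinuousLinearMap.adjoint (toCLM H X) ∘L toCLM H Y : H →L[ℂ] H) : H →ₗ[ℂ] H)

lemma hsInner_eq_toLp (X Y : HilbertSchmidt H) : hsInner X Y = ⟪toLp H X, toLp H Y⟫_ℂ := by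
  rw [hsInner, lp.inner_eq_tsum, trace]
  simp only [ContinuousLinearMap.coe_coe, ContinuousLinearMap.comp_apply,
    ContinuousLinearMap.adjoint_inner_right]
  rfl

variable (H) in
/-- `tr(X* Y)` is an inner product. -/
@[reducible]
def core : InnerProductSpace.Core ℂ (HilbertSchmidt H) where
  inner := hsInner
  conj_inner_symm X Y := by
    rw [hsInner_eq_toLp, hsInner_eq_toLp, inner_conj_symm]
  re_inner_nonneg X := by
    rw [hsInner_eq_toLp]
    exact inner_self_nonneg
  add_left X Y Z := by
    simp only [hsInner_eq_toLp, map_add, inner_add_left]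
  smul_left X Y c := by
    simp only [hsInner_eq_toLp, map_smul, inner_smul_left]
  definite X h := by
    rw [hsInner_eq_toLp, inner_self_eq_zero] at h
    exact toLp_injective (h.trans (map_zero _).symm)

instance : NormedAddCommGroup (HilbertSchmidt H) := (core H).toNormedAddCommGroup

instance : InnerProductSpace ℂ (HilbertSchmidt H) := InnerProductSpace.ofCore (core H).toCore

lemma inner_def (X Y : HilbertSchmidt H) : ⟪X, Y⟫_ℂ =
    trace ((ContinuousLinearMap.adjoint (toCLM H X) ∘L toCLM H Y : H →L[ℂ] H) : H →ₗ[ℂ] H) := rfl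

lemma norm_toLp (X : HilbertSchmidt H) : ‖toLp H X‖ = ‖X‖ := by
  rw [@norm_eq_sqrt_re_inner ℂ, @norm_eq_sqrt_re_inner ℂ, ← hsInner_eq_toLp]
  rfl

lemma toLp_surjective : Function.Surjective (toLp H) := by
  intro h
  have hh : Summable fun j => ‖h j‖ ^ 2 := by
    have := lp.memℓp h
    rw [memℓp_gen_iff (by simp)] at this
    simpa using this
  set C : ℝ := √(∑' j, ‖h j‖ ^ 2) with hC
  have hF : ∀ (z : H) (F : Finset (onbIndex H)),
      ∑ j ∈ F, ‖⟪onb H j, z⟫_ℂ • h j‖ ≤ C * ‖z‖ := fun z F => by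
    calc ∑ j ∈ F, ‖⟪onb H j, z⟫_ℂ • h j‖
        = ∑ j ∈ F, ‖h j‖ * ‖⟪onb H j, z⟫_ℂ‖ :=
          Finset.sum_congr rfl fun j _ => by rw [norm_smul, mul_comm]
      _ ≤ √(∑ j ∈ F, ‖h j‖ ^ 2) * √(∑ j ∈ F, ‖⟪onb H j, z⟫_ℂ‖ ^ 2) :=
          Real.sum_mul_le_sqrt_mul_sqrt _ _ _
      _ ≤ C * ‖z‖ := by
          gcongr
          · exact Real.sqrt_le_sqrt (hh.sum_le_tsum F fun _ _ => by positivity)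
          · exact Real.sqrt_le_iff.2
              ⟨norm_nonneg _, (onb H).orthonormal.sum_inner_products_le z⟩
  have hn : ∀ z : H, Summable fun j => ‖⟪onb H j, z⟫_ℂ • h j‖ := fun z =>
    summable_of_sum_le (fun _ => norm_nonneg _) (hF z)
  have hs : ∀ z : H, Summable fun j => ⟪onb H j, z⟫_ℂ • h j := fun z => (hn z).of_norm
  let T : H →L[ℂ] H := LinearMap.mkContinuous
    { toFun := fun z => ∑' j, ⟪onb H j, z⟫_ℂ • h j
      map_add' := fun x y => by
        simp only [inner_add_right, add_smul]
        exact (hs x).tsum_add (hs y)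
      map_smul' := fun c x => by
        simp only [inner_smul_right, mul_smul, RingHom.id_apply]
        exact (hs x).tsum_const_smul c } C fun z =>
      (norm_tsum_le_tsum_norm (hn z)).trans (Real.tsum_le_of_sum_le (fun _ => norm_nonneg _) (hF z))
  have hT : ∀ k, T (onb H k) = h k := fun k => by
    change ∑' j, ⟪onb H j, onb H k⟫_ℂ • h j = h k
    rw [tsum_eq_single k fun j hj => by rw [(onb H).orthonormal.2 hj, zero_smul]]
    simp [(onb H).orthonormal.1 k]
  refine ⟨⟨T, isHilbertSchmidt_iff_memℓp.2 ?_⟩, ?_⟩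
  · simp only [hT]
    exact lp.memℓp h
  · ext k
    exact hT k

instance : CompleteSpace (HilbertSchmidt H) := by
  let e : HilbertSchmidt H ≃ₗᵢ[ℂ] lp (fun _ : onbIndex H => H) 2 :=
    { LinearEquiv.ofBijective (toLp H) ⟨toLp_injective, toLp_surjective⟩ with
      norm_map' := norm_toLp }
  exact e.symm.toIsometryEquiv.completeSpace_iff.1 inferInstance

end HilbertSchmidt

/-- The inclusion `𝓑¹(H) ⊆ 𝓑²(H)`. -/
def TraceClass.toHilbertSchmidt : TraceClass H →ₗ[ℂ] HilbertSchmidt H :=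
  Submodule.inclusion (p := TraceClass H) (p' := hilbertSchmidtSubmodule H)
    fun _ hA => IsTraceClass.isHilbertSchmidt hA

/-! ### Superoperators -/

/-- The map `X ↦ B* X B` from `𝓑²(H)` to `𝓑¹(H)`, for `B` trace class. -/
def sandwich (B : TraceClass H) : HilbertSchmidt H →ₗ[ℂ] TraceClass H where
  toFun X := ⟨ContinuousLinearMap.adjoint (B : H →L[ℂ] H) ∘L HilbertSchmidt.toCLM H X ∘L
    (B : H →L[ℂ] H), (IsTraceClass.clm_comp B.2 _).clm_comp _⟩
  map_add' X Y := by ext z; simp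
  map_smul' c X := by ext z; simp

/-- The map `Φ(B* (·) B)` on the Hilbert space `𝓑²(H)`. -/
def weighted (Φ : TraceClass H →ₗ[ℂ] TraceClass H) (B : TraceClass H) :
    HilbertSchmidt H →ₗ[ℂ] HilbertSchmidt H :=
  TraceClass.toHilbertSchmidt ∘ₗ Φ ∘ₗ sandwich B

/-- The map `A ↦ K A + A K*` on `𝓑¹(H)`. -/
def leftRight (K : H →L[ℂ] H) : TraceClass H →ₗ[ℂ] TraceClass H where
  toFun A := ⟨K ∘L (A : H →L[ℂ] H) + (A : H →L[ℂ] H) ∘L ContinuousLinearMap.adjoint K,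
    (IsTraceClass.clm_comp A.2 _).add (IsTraceClass.comp_clm A.2 _)⟩
  map_add' A C := by ext z; simp; abel
  map_smul' c A := by ext z; simp

/-- The operator on `ℂⁿ ⊗ H = H × ⋯ × H` (with the `ℓ²` norm) given by an `n × n` matrix of
operators on `H`. -/
def blockOp {n : ℕ} (A : Matrix (Fin n) (Fin n) (H →L[ℂ] H)) :
    PiLp 2 (fun _ : Fin n => H) →L[ℂ] PiLp 2 (fun _ : Fin n => H) :=
  ((PiLp.continuousLinearEquiv 2 ℂ (fun _ : Fin n => H)).symm :
      (Fin n → H) →L[ℂ] PiLp 2 (fun _ : Fin n => H)) ∘L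
    ContinuousLinearMap.pi fun i => ∑ j, A i j ∘L PiLp.proj 2 (fun _ : Fin n => H) j

/-- `Φ` is `n`-positive: `idₙ ⊗ Φ`, which applies `Φ` to every entry of an `n × n` matrix of
trace-class operators, preserves positive semidefiniteness. -/
def IsNPositive (n : ℕ) (Φ : TraceClass H →ₗ[ℂ] TraceClass H) : Prop :=
  ∀ A : Matrix (Fin n) (Fin n) (TraceClass H),
    (blockOp (A.map fun a => (a : H →L[ℂ] H))).IsPositive →
      (blockOp (A.map fun a => (Φ a : H →L[ℂ] H))).IsPositive

/-- The set `CP(H)` of completely positive linear maps on `𝓑¹(H)`. -/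
def CP (H : Type*) [NormedAddCommGroup H] [InnerProductSpace ℂ H] [CompleteSpace H] :
    Set (TraceClass H →ₗ[ℂ] TraceClass H) :=
  {Φ | ∀ n, IsNPositive n Φ}

/-- The set `CP_B(H)` of all `Φ` in `CP(H)` for which the trace of `Φ(B* (·) B)`, an operator on the
Hilbert space `𝓑²(H)`, vanishes. -/
def CPWeighted (B : TraceClass H) : Set (TraceClass H →ₗ[ℂ] TraceClass H) :=
  {Φ | Φ ∈ CP H ∧ trace (weighted Φ B) = 0}

end QDyn

end

/-! Write `B = ∑ₙ |xₙ⟩⟨yₙ|` with `∑ₙ ‖xₙ‖²` and `∑ₙ ‖yₙ‖²` finite. A positive functional on the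
trace class is automatically normal, so `Φ(B* X B)` may be expanded termwise, and the trace of
`Φ(B* (·) B)` is `∑ₘₙ ⟨xₘ, Φ(|yₘ⟩⟨yₙ|) xₙ⟩`. This is the value at `B` of the positive
semidefinite sesquilinear form that complete positivity attaches to `Φ`; if it vanishes, then by
Cauchy-Schwarz `B` is orthogonal to every rank-one operator: `∑ₙ ⟨xₙ, Φ(|yₙ⟩⟨w|) v⟩ = 0` for all
`w` and `v`. Applied to `K A + A K* = Φ₁(A) - Φ₂(A)`, this reads
`tr(B* K) ⟨w, v⟩ + conj(tr B) ⟨K w, v⟩ = 0`. Hence `K` is a scalar `c`, and then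
`tr(B* K) = c conj(tr B)` forces `c = -conj(c)`.
-/

noncomputable section

namespace QDyn

open scoped InnerProductSpace ComplexOrder
open Filter Topology

variable {H : Type*} [NormedAddCommGroup H] [InnerProductSpace ℂ H] [CompleteSpace H]

section Summability

variable {ι : Type*}

lemma summable_mul_of_summable_sq {a b : ι → ℝ} (ha : Summable fun n => a n ^ 2)
    (hb : Summable fun n => b n ^ 2) : Summable fun n => a n * b n :=
  (ha.add hb).of_norm_bounded fun n => by
    rw [Real.norm_eq_abs, abs_le]
    constructor <;> nlinarith [sq_nonneg (a n - b n), sq_nonneg (a n + b n)]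

lemma summable_norm_add_sq {E : Type*} [SeminormedAddCommGroup E] {x y : ι → E}
    (hx : Summable fun n => ‖x n‖ ^ 2) (hy : Summable fun n => ‖y n‖ ^ 2) :
    Summable fun n => ‖x n + y n‖ ^ 2 :=
  ((hx.add hy).mul_left 2).of_nonneg_of_le (fun n => by positivity) fun n => by
    nlinarith [norm_add_le (x n) (y n), norm_nonneg (x n + y n), sq_nonneg (‖x n‖ - ‖y n‖)]

end Summability

section PositiveOperators

variable {E : Type*} [NormedAddCommGroup E] [InnerProductSpace ℂ E]

lemma isPositive_of_inner_nonneg {T : E →L[ℂ] E} (h : ∀ z, 0 ≤ ⟪z, T z⟫_ℂ) : T.IsPositive := by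
  rw [ContinuousLinearMap.isPositive_iff_complex]
  intro z
  have hz : 0 ≤ ⟪T z, z⟫_ℂ := by
    rw [← inner_conj_symm]
    exact star_nonneg_iff.2 (h z)
  obtain ⟨hre, him⟩ := Complex.nonneg_iff.1 hz
  exact ⟨Complex.ext rfl him, hre⟩

lemma isPositive_sub_sum_of_hasSum {κ : Type*} {Q : E →L[ℂ] E} {A : κ → E →L[ℂ] E}
    (hA : ∀ k, (A k).IsPositive) (hQ : ∀ z, HasSum (fun k => ⟪z, A k z⟫_ℂ) ⟪z, Q z⟫_ℂ)
    (F : Finset κ) : (Q - ∑ k ∈ F, A k).IsPositive := by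
  refine isPositive_of_inner_nonneg fun z => ?_
  have hle := sum_le_hasSum F (fun k _ => (hA k).inner_nonneg_right z) (hQ z)
  simpa [sum_apply, inner_sub_right, inner_sum] using hle

lemma norm_inner_sq_le_of_isPositive [CompleteSpace E] {T : E →L[ℂ] E} (hT : T.IsPositive)
    (u v : E) : ‖⟪u, T v⟫_ℂ‖ ^ 2 ≤ (⟪u, T u⟫_ℂ).re * (⟪v, T v⟫_ℂ).re := by
  obtain ⟨S, rfl⟩ := CStarAlgebra.nonneg_iff_eq_star_mul_self.1
    ((ContinuousLinearMap.nonneg_iff_isPositive T).2 hT)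
  have hS : ∀ a b, ⟪a, (star S * S) b⟫_ℂ = ⟪S a, S b⟫_ℂ := fun a b =>
    ContinuousLinearMap.adjoint_inner_right S a (S b)
  have hre : ∀ a, (⟪S a, S a⟫_ℂ).re = ‖S a‖ ^ 2 := fun a => (norm_sq_eq_re_inner (𝕜 := ℂ) _).symm
  rw [hS, hS, hS, hre, hre, ← mul_pow]
  gcongr
  exact norm_inner_le_norm _ _

lemma HasNuclearSum.hasSum_inner {ι : Type*} {A : E →L[ℂ] E} {x y : ι → E}
    (h : HasNuclearSum A x y) (u v : E) :
    HasSum (fun n => ⟪y n, v⟫_ℂ * ⟪u, x n⟫_ℂ) ⟪u, A v⟫_ℂ := by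
  simpa [inner_smul_right] using (innerSL ℂ u).hasSum (h.2 v)

lemma HasNuclearSum.isPositive {ι : Type*} {A : E →L[ℂ] E} {c : ι → E}
    (h : HasNuclearSum A c c) : A.IsPositive :=
  isPositive_of_inner_nonneg fun z => (h.hasSum_inner z z).nonneg fun n => by
    rw [← inner_conj_symm z (c n), Complex.mul_conj]
    exact_mod_cast Complex.normSq_nonneg _

lemma HasNuclearSum.indicator_compl {ι : Type*} {A : E →L[ℂ] E} {x y : ι → E}
    (h : HasNuclearSum A x y) (F : Finset ι) :
    HasNuclearSum (A - ∑ n ∈ F, InnerProductSpace.rankOne ℂ (x n) (y n))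
      ((F : Set ι)ᶜ.indicator x) ((F : Set ι)ᶜ.indicator y) := by
  refine ⟨h.1.of_nonneg_of_le (fun n => by positivity) fun n => ?_, fun z => ?_⟩
  · gcongr <;> exact norm_indicator_le_norm_self _ _
  · have hF : HasSum (fun n => ⟪y n, z⟫_ℂ • x n)
        ((A z - ∑ n ∈ F, ⟪y n, z⟫_ℂ • x n) + ∑ n ∈ F, ⟪y n, z⟫_ℂ • x n) := by
      simpa using h.2 z
    have hFc : HasSum ((F : Set ι)ᶜ.indicator fun n => ⟪y n, z⟫_ℂ • x n)
        (A z - ∑ n ∈ F, ⟪y n, z⟫_ℂ • x n) :=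
      hasSum_subtype_iff_indicator.1 (F.hasSum_compl_iff.2 hF)
    convert hFc using 2 with n
    · by_cases hn : n ∈ F <;> simp [hn]
    · simp [sum_apply]

end PositiveOperators

section NuclearSums

variable {ι : Type*} {A : H →L[ℂ] H} {x y : ι → H}

lemma exists_hasNuclearSum (h : Summable fun n => ‖x n‖ * ‖y n‖) :
    ∃ A : TraceClass H, HasNuclearSum (A : H →L[ℂ] H) x y := by
  obtain ⟨T, hT⟩ : Summable fun n => InnerProductSpace.rankOne ℂ (x n) (y n) :=
    Summable.of_norm (by simpa using h)
  have hA : HasNuclearSum T x y := ⟨h, fun z => by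
    simpa using (ContinuousLinearMap.apply ℂ H z).hasSum hT⟩
  exact ⟨⟨T, hA.isTraceClass⟩, hA⟩

lemma HasNuclearSum.adjoint (h : HasNuclearSum A x y) :
    HasNuclearSum (ContinuousLinearMap.adjoint A) y x := by
  obtain ⟨C, hC⟩ := exists_hasNuclearSum (x := y) (y := x) (by simpa [mul_comm] using h.1)
  suffices ContinuousLinearMap.adjoint A = C by rwa [this]
  ext z
  refine ext_inner_left ℂ fun u => ?_
  rw [ContinuousLinearMap.adjoint_inner_right, ← inner_conj_symm]
  refine (Complex.hasSum_conj'.2 (h.hasSum_inner z u)).unique ((hC.hasSum_inner u z).congr_fun ?_)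
  exact fun n => by simp [mul_comm]

lemma HasNuclearSum.comp_clm_comp {κ : Type*} {C : H →L[ℂ] H} {x' y' : κ → H}
    (hA : HasNuclearSum A x y) (hC : HasNuclearSum C x' y') (X : H →L[ℂ] H) :
    HasNuclearSum (A ∘L X ∘L C) (fun p : ι × κ => ⟪y p.1, X (x' p.2)⟫_ℂ • x p.1)
      (fun p => y' p.2) := by
  have hsum : Summable fun p : ι × κ => ‖⟪y p.1, X (x' p.2)⟫_ℂ • x p.1‖ * ‖y' p.2‖ := by
    have hprod := hA.1.mul_of_nonneg hC.1 (fun _ => by positivity) (fun _ => by positivity)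
    refine (hprod.mul_left ‖X‖).of_nonneg_of_le (fun p => by positivity) fun p => ?_
    have hX : ‖⟪y p.1, X (x' p.2)⟫_ℂ‖ ≤ ‖y p.1‖ * (‖X‖ * ‖x' p.2‖) :=
      (norm_inner_le_norm _ _).trans (by gcongr; exact X.le_opNorm _)
    rw [norm_smul]
    calc ‖⟪y p.1, X (x' p.2)⟫_ℂ‖ * ‖x p.1‖ * ‖y' p.2‖
        ≤ ‖y p.1‖ * (‖X‖ * ‖x' p.2‖) * ‖x p.1‖ * ‖y' p.2‖ := by gcongr
      _ = ‖X‖ * (‖x p.1‖ * ‖y p.1‖ * (‖x' p.2‖ * ‖y' p.2‖)) := by ring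
  obtain ⟨D, hD⟩ := exists_hasNuclearSum hsum
  suffices A ∘L X ∘L C = D by rwa [this]
  ext z
  refine (hA.2 (X (C z))).unique ((hD.2 z).prod_fiberwise fun m => ?_)
  have hm := ((innerSL ℂ (y m)).hasSum (X.hasSum (hC.2 z))).smul_const (x m)
  simpa [inner_smul_right, smul_smul] using hm

/-- The rank-one operator `|x⟩⟨y|` as an element of the trace class. -/
def ketBra (x y : H) : TraceClass H :=
  ⟨InnerProductSpace.rankOne ℂ x y, HasNuclearSum.isTraceClass (ι := Unit)
    (x := fun _ => x) (y := fun _ => y) ⟨Summable.of_finite, fun z => by simp⟩⟩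

@[simp]
lemma coe_ketBra (x y : H) : (ketBra x y : H →L[ℂ] H) = InnerProductSpace.rankOne ℂ x y := rfl

lemma isPositive_ketBra_self (x : H) : (ketBra x x : H →L[ℂ] H).IsPositive :=
  InnerProductSpace.isPositive_rankOne_self x

lemma ketBra_smul_left (c : ℂ) (x y : H) : ketBra (c • x) y = c • ketBra x y := by
  ext z; simp

lemma ketBra_smul_right (c : ℂ) (x y : H) : ketBra x (c • y) = star c • ketBra x y := by
  ext z; simp

lemma four_smul_ketBra (x y : H) : (4 : ℂ) • ketBra x y =
    ketBra (x + y) (x + y) - ketBra (x - y) (x - y)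
      + Complex.I • ketBra (x + Complex.I • y) (x + Complex.I • y)
      - Complex.I • ketBra (x - Complex.I • y) (x - Complex.I • y) := by
  ext z
  simp only [SetLike.val_smul, coe_ketBra, AddSubgroupClass.coe_sub, Submodule.coe_add,
    add_apply, sub_apply, smul_apply, InnerProductSpace.rankOne_apply, inner_add_left,
    inner_sub_left, inner_smul_left, Complex.conj_I]
  match_scalars <;> ring_nf <;> simp only [Complex.I_sq] <;> ring

lemma exists_ketBra_eq_norm_sq_eq (x y : H) : ∃ x' y' : H, ketBra x' y' = ketBra x y ∧
    ‖x'‖ ^ 2 = ‖x‖ * ‖y‖ ∧ ‖y'‖ ^ 2 = ‖x‖ * ‖y‖ := by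
  rcases eq_or_ne x 0 with rfl | hx
  · exact ⟨0, 0, by ext z; simp, by simp, by simp⟩
  rcases eq_or_ne y 0 with rfl | hy
  · exact ⟨0, 0, by ext z; simp, by simp, by simp⟩
  set t : ℝ := √(‖y‖ / ‖x‖)
  have ht0 : 0 < t := by positivity
  have htsq : t ^ 2 = ‖y‖ / ‖x‖ := Real.sq_sqrt (by positivity)
  refine ⟨(t : ℂ) • x, ((t⁻¹ : ℝ) : ℂ) • y, ?_, ?_, ?_⟩
  · rw [ketBra_smul_left, ketBra_smul_right, smul_smul, Complex.star_def, Complex.conj_ofReal,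
      ← Complex.ofReal_mul, mul_inv_cancel₀ ht0.ne', Complex.ofReal_one, one_smul]
  · rw [norm_smul, Complex.norm_real, mul_pow, Real.norm_eq_abs, sq_abs, htsq]
    field_simp
  · rw [norm_smul, Complex.norm_real, mul_pow, Real.norm_eq_abs, sq_abs, inv_pow, htsq]
    field_simp

lemma HasNuclearSum.congr_ketBra {x' y' : ι → H} (h : HasNuclearSum A x y)
    (hsum : Summable fun n => ‖x' n‖ * ‖y' n‖)
    (heq : ∀ n, ketBra (x' n) (y' n) = ketBra (x n) (y n)) : HasNuclearSum A x' y' :=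
  ⟨hsum, fun z => (h.2 z).congr_fun fun n =>
    congrArg (fun C : TraceClass H => (C : H →L[ℂ] H) z) (heq n)⟩

lemma HasNuclearSum.exists_summable_norm_sq (h : HasNuclearSum A x y) :
    ∃ x' y' : ι → H, (∀ n, ketBra (x' n) (y' n) = ketBra (x n) (y n)) ∧ HasNuclearSum A x' y' ∧
      (Summable fun n => ‖x' n‖ ^ 2) ∧ Summable fun n => ‖y' n‖ ^ 2 := by
  choose x' y' heq hx hy using fun n => exists_ketBra_eq_norm_sq_eq (x n) (y n)
  have hxy : ∀ n, ‖x' n‖ * ‖y' n‖ = ‖x n‖ * ‖y n‖ := fun n => by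
    have hsq : (‖x' n‖ * ‖y' n‖) ^ 2 = (‖x n‖ * ‖y n‖) ^ 2 := by rw [mul_pow, hx, hy, sq]
    exact (pow_left_inj₀ (by positivity) (by positivity) two_ne_zero).1 hsq
  exact ⟨x', y', heq, h.congr_ketBra (by simpa only [hxy] using h.1) heq,
    by simpa only [hx] using h.1, by simpa only [hy] using h.1⟩

end NuclearSums

/-! ### Normality of positive functionals on the trace class -/

section Normality

/-- A linear functional on the trace class, not assumed continuous, that is nonnegative on positive
operators. Nonnegativity is in the order of `ℂ`, so the values there are real. -/
def IsPositiveFunctional (φ : TraceClass H →ₗ[ℂ] ℂ) : Prop :=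
  ∀ A : TraceClass H, (A : H →L[ℂ] H).IsPositive → 0 ≤ φ A

variable {ι : Type*} {φ : TraceClass H →ₗ[ℂ] ℂ}

lemma IsPositiveFunctional.re_nonneg (hφ : IsPositiveFunctional φ) {A : TraceClass H}
    (hA : (A : H →L[ℂ] H).IsPositive) : 0 ≤ (φ A).re :=
  (Complex.nonneg_iff.1 (hφ A hA)).1

lemma IsPositiveFunctional.sum_re_le {κ : Type*} (hφ : IsPositiveFunctional φ) {Q : TraceClass H}
    {A : κ → TraceClass H} (hA : ∀ k, (A k : H →L[ℂ] H).IsPositive)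
    (hQ : ∀ z, HasSum (fun k => ⟪z, (A k : H →L[ℂ] H) z⟫_ℂ) ⟪z, (Q : H →L[ℂ] H) z⟫_ℂ)
    (F : Finset κ) : ∑ k ∈ F, (φ (A k)).re ≤ (φ Q).re := by
  have hpos : ((Q - ∑ k ∈ F, A k : TraceClass H) : H →L[ℂ] H).IsPositive := by
    simpa using isPositive_sub_sum_of_hasSum hA hQ F
  simpa using hφ.re_nonneg hpos

/-- Gliding hump: operators `A k` with `φ (A k) ≥ ε` and rapidly decreasing trace norms would add up
to a trace-class operator on which `φ` exceeds every multiple of `ε`. -/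
lemma IsPositiveFunctional.exists_forall_re_lt (ι : Type*) (hφ : IsPositiveFunctional φ) {ε : ℝ}
    (hε : 0 < ε) : ∃ δ > 0, ∀ (A : TraceClass H) (c : ι → H),
      HasNuclearSum (A : H →L[ℂ] H) c c → ∑' n, ‖c n‖ * ‖c n‖ < δ → (φ A).re < ε := by
  by_contra! hlarge
  choose A c hA hlt hge using fun k : ℕ => hlarge ((1 / 2) ^ k) (by positivity)
  have hsum : Summable fun p : ℕ × ι => ‖c p.1 p.2‖ * ‖c p.1 p.2‖ :=
    (summable_prod_of_nonneg fun _ => by positivity).2 ⟨fun k => (hA k).1,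
      summable_geometric_two.of_nonneg_of_le (fun k => tsum_nonneg fun n => by positivity)
        fun k => (hlt k).le⟩
  obtain ⟨Q, hQ⟩ := exists_hasNuclearSum hsum
  have hQinner : ∀ z, HasSum (fun k => ⟪z, (A k : H →L[ℂ] H) z⟫_ℂ) ⟪z, (Q : H →L[ℂ] H) z⟫_ℂ :=
    fun z => (hQ.hasSum_inner z z).prod_fiberwise fun k => (hA k).hasSum_inner z z
  obtain ⟨m, hm⟩ := exists_nat_gt ((φ Q).re / ε)
  have hmε : m * ε ≤ (φ Q).re := calc
    m * ε = ∑ _k ∈ Finset.range m, ε := by simp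
    _ ≤ ∑ k ∈ Finset.range m, (φ (A k)).re := Finset.sum_le_sum fun k _ => hge k
    _ ≤ (φ Q).re := hφ.sum_re_le (fun k => (hA k).isPositive) hQinner _
  rw [div_lt_iff₀ hε] at hm
  linarith

lemma HasNuclearSum.hasSum_of_isPositiveFunctional_self (hφ : IsPositiveFunctional φ)
    {A : TraceClass H} {c : ι → H} (h : HasNuclearSum (A : H →L[ℂ] H) c c) :
    HasSum (fun n => φ (ketBra (c n) (c n))) (φ A) := by
  refine Metric.tendsto_nhds.2 fun ε hε => ?_
  obtain ⟨δ, hδ, hsmall⟩ := hφ.exists_forall_re_lt ι hε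
  filter_upwards [(tendsto_tsum_compl_atTop_zero fun n => ‖c n‖ * ‖c n‖).eventually_lt_const hδ]
    with F hF
  set R : TraceClass H := A - ∑ n ∈ F, ketBra (c n) (c n)
  have hR : HasNuclearSum (R : H →L[ℂ] H) ((F : Set ι)ᶜ.indicator c)
      ((F : Set ι)ᶜ.indicator c) := by
    simpa [R] using h.indicator_compl F
  have htail : ∑' n, ‖(F : Set ι)ᶜ.indicator c n‖ * ‖(F : Set ι)ᶜ.indicator c n‖ < δ := by
    simp only [norm_indicator_eq_indicator_norm, ← Set.indicator_mul]
    rwa [← tsum_subtype]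
  calc dist (∑ n ∈ F, φ (ketBra (c n) (c n))) (φ A)
      = ‖φ R‖ := by rw [dist_comm, dist_eq_norm, map_sub, map_sum]
    _ = (φ R).re := (Complex.re_eq_norm.2 (hφ R hR.isPositive)).symm
    _ < ε := hsmall R _ hR htail

lemma exists_hasNuclearSum_add_smul_self {x y : ι → H} (hx : Summable fun n => ‖x n‖ ^ 2)
    (hy : Summable fun n => ‖y n‖ ^ 2) (w : ℂ) : ∃ P : TraceClass H,
      HasNuclearSum (P : H →L[ℂ] H) (fun n => x n + w • y n) (fun n => x n + w • y n) := by
  have hsq : Summable fun n => ‖x n + w • y n‖ ^ 2 :=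
    summable_norm_add_sq hx (by simpa only [norm_smul, mul_pow] using hy.mul_left (‖w‖ ^ 2))
  exact exists_hasNuclearSum (summable_mul_of_summable_sq hsq hsq)

lemma HasNuclearSum.hasSum_of_isPositiveFunctional (hφ : IsPositiveFunctional φ)
    {A : TraceClass H} {x y : ι → H} (h : HasNuclearSum (A : H →L[ℂ] H) x y) :
    HasSum (fun n => φ (ketBra (x n) (y n))) (φ A) := by
  obtain ⟨x', y', heq, h', hx, hy⟩ := h.exists_summable_norm_sq
  simp only [← heq]
  obtain ⟨P₁, h₁⟩ := exists_hasNuclearSum_add_smul_self hx hy 1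
  obtain ⟨P₂, h₂⟩ := exists_hasNuclearSum_add_smul_self hx hy (-1)
  obtain ⟨P₃, h₃⟩ := exists_hasNuclearSum_add_smul_self hx hy Complex.I
  obtain ⟨P₄, h₄⟩ := exists_hasNuclearSum_add_smul_self hx hy (-Complex.I)
  simp only [one_smul, neg_smul, ← sub_eq_add_neg] at h₁ h₂ h₃ h₄
  have hA : (4 : ℂ) • A = P₁ - P₂ + Complex.I • P₃ - Complex.I • P₄ := by
    ext z
    refine ((h'.2 z).const_smul (4 : ℂ)).unique (HasSum.congr_fun ?_ fun n =>
      congrArg (fun C : TraceClass H => (C : H →L[ℂ] H) z) (four_smul_ketBra (x' n) (y' n)))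
    exact (((h₁.2 z).sub (h₂.2 z)).add ((h₃.2 z).const_smul Complex.I)).sub
      ((h₄.2 z).const_smul Complex.I)
  have hφA : HasSum (fun n => φ ((4 : ℂ) • ketBra (x' n) (y' n))) (φ ((4 : ℂ) • A)) := by
    simp only [hA, four_smul_ketBra, map_sub, map_add, map_smul]
    exact (((h₁.hasSum_of_isPositiveFunctional_self hφ).sub
      (h₂.hasSum_of_isPositiveFunctional_self hφ)).add
      ((h₃.hasSum_of_isPositiveFunctional_self hφ).const_smul Complex.I)).sub
      ((h₄.hasSum_of_isPositiveFunctional_self hφ).const_smul Complex.I)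
  simpa using hφA.const_smul (4⁻¹ : ℂ)

end Normality

/-! ### Traces and Hilbert-Schmidt inner products -/

section Trace

variable {E : Type*} [NormedAddCommGroup E] [InnerProductSpace ℂ E]

lemma sum_norm_inner_mul_le_of_orthonormal {κ : Type*} {e : κ → E} (he : Orthonormal ℂ e)
    (x y : E) (F : Finset κ) : ∑ k ∈ F, ‖⟪y, e k⟫_ℂ * ⟪e k, x⟫_ℂ‖ ≤ ‖x‖ * ‖y‖ := by
  calc ∑ k ∈ F, ‖⟪y, e k⟫_ℂ * ⟪e k, x⟫_ℂ‖
      = ∑ k ∈ F, ‖⟪e k, x⟫_ℂ‖ * ‖⟪e k, y⟫_ℂ‖ :=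
        Finset.sum_congr rfl fun k _ => by rw [norm_mul, mul_comm, norm_inner_symm y]
    _ ≤ √(∑ k ∈ F, ‖⟪e k, x⟫_ℂ‖ ^ 2) * √(∑ k ∈ F, ‖⟪e k, y⟫_ℂ‖ ^ 2) :=
        Real.sum_mul_le_sqrt_mul_sqrt _ _ _
    _ ≤ ‖x‖ * ‖y‖ := by
        gcongr
        · exact Real.sqrt_le_iff.2 ⟨norm_nonneg _, he.sum_inner_products_le x⟩
        · exact Real.sqrt_le_iff.2 ⟨norm_nonneg _, he.sum_inner_products_le y⟩

variable [CompleteSpace E]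

lemma hasSum_trace {ι : Type*} {T : E →ₗ[ℂ] E} {x y : ι → E}
    (h : Summable fun n => ‖x n‖ * ‖y n‖) (hT : ∀ z, HasSum (fun n => ⟪y n, z⟫_ℂ • x n) (T z)) :
    HasSum (fun n => ⟪y n, x n⟫_ℂ) (trace T) := by
  let a : ι × onbIndex E → ℂ := fun p => ⟪y p.1, onb E p.2⟫_ℂ * ⟪onb E p.2, x p.1⟫_ℂ
  have hle := fun n F => sum_norm_inner_mul_le_of_orthonormal (onb E).orthonormal (x n) (y n) F
  have ha : Summable a := by
    refine Summable.of_norm ((summable_prod_of_nonneg fun p => norm_nonneg _).2 ⟨fun n => ?_, ?_⟩)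
    · exact summable_of_sum_le (fun _ => norm_nonneg _) (hle n)
    · exact h.of_nonneg_of_le (fun n => tsum_nonneg fun _ => norm_nonneg _)
        fun n => Real.tsum_le_of_sum_le (fun _ => norm_nonneg _) (hle n)
  have hrows : HasSum (fun n => ⟪y n, x n⟫_ℂ) (∑' p, a p) :=
    ha.hasSum.prod_fiberwise fun n => (onb E).hasSum_inner_mul_inner (y n) (x n)
  have hcols : HasSum (fun j => ⟪onb E j, T (onb E j)⟫_ℂ) (∑' p, a p) :=
    ((Equiv.prodComm _ _).hasSum_iff.2 ha.hasSum).prod_fiberwise fun j => by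
      simpa [a, inner_smul_right] using (innerSL ℂ (onb E j)).hasSum (hT (onb E j))
  rwa [trace, hcols.tsum_eq]

lemma trace_adjoint (T : E →L[ℂ] E) :
    trace (ContinuousLinearMap.adjoint T : E →ₗ[ℂ] E) = star (trace (T : E →ₗ[ℂ] E)) := by
  simp only [trace, Complex.star_def, Complex.conj_tsum, ContinuousLinearMap.coe_coe,
    ContinuousLinearMap.adjoint_inner_right, inner_conj_symm]

lemma trace_smul (c : ℂ) (T : E →ₗ[ℂ] E) : trace (c • T) = c * trace T := by
  simp only [trace, LinearMap.smul_apply, inner_smul_right, tsum_mul_left]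

lemma hasSum_norm_inner_onb_sq (z : E) : HasSum (fun i => ‖⟪onb E i, z⟫_ℂ‖ ^ 2) (‖z‖ ^ 2) := by
  have h := (onb E).hasSum_inner_mul_inner z z
  rw [← Complex.hasSum_ofReal, Complex.ofReal_pow]
  rw [inner_self_eq_norm_sq_to_K] at h
  refine h.congr_fun fun i => ?_
  rw [← inner_conj_symm z, Complex.conj_mul', Complex.ofReal_pow]

lemma HasNuclearSum.hasSum_trace_adjoint_comp {ι : Type*} {B : E →L[ℂ] E} {x y : ι → E}
    (hB : HasNuclearSum B x y) (L : E →L[ℂ] E) :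
    HasSum (fun n => ⟪x n, L (y n)⟫_ℂ)
      (trace ((ContinuousLinearMap.adjoint B ∘L L : E →L[ℂ] E) : E →ₗ[ℂ] E)) := by
  have hBL := hB.adjoint.comp_clm L
  simpa only [ContinuousLinearMap.adjoint_inner_left] using hasSum_trace hBL.1 hBL.2

end Trace

section TraceClass

lemma TraceClass.hasSum_inner_onb (A : TraceClass H) :
    HasSum (fun k => ⟪onb H k, (A : H →L[ℂ] H) (onb H k)⟫_ℂ)
      (trace ((A : H →L[ℂ] H) : H →ₗ[ℂ] H)) := by
  obtain ⟨_, _, _, h⟩ := A.2.exists_nuclear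
  exact (h.summable_inner (onb H).orthonormal (onb H).orthonormal).of_norm.hasSum

variable (H) in
/-- The trace as a linear functional on the trace class. -/
def traceFunctional : TraceClass H →ₗ[ℂ] ℂ where
  toFun A := trace ((A : H →L[ℂ] H) : H →ₗ[ℂ] H)
  map_add' A C := by
    refine (TraceClass.hasSum_inner_onb (A + C)).unique ?_
    simpa [inner_add_right] using
      (TraceClass.hasSum_inner_onb A).add (TraceClass.hasSum_inner_onb C)
  map_smul' c A := by
    refine (TraceClass.hasSum_inner_onb (c • A)).unique ?_
    simpa [inner_smul_right] using (TraceClass.hasSum_inner_onb A).mul_left c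

lemma isPositiveFunctional_traceFunctional : IsPositiveFunctional (traceFunctional H) :=
  fun A hA => (TraceClass.hasSum_inner_onb A).nonneg fun _ => hA.inner_nonneg_right _

/-- The vector functional `A ↦ ⟨u, A u⟩` on the trace class. -/
def vectorFunctional (u : H) : TraceClass H →ₗ[ℂ] ℂ where
  toFun A := ⟪u, (A : H →L[ℂ] H) u⟫_ℂ
  map_add' A C := by simp
  map_smul' c A := by simp

lemma isPositiveFunctional_vectorFunctional (u : H) : IsPositiveFunctional (vectorFunctional u) :=
  fun _ hA => hA.inner_nonneg_right u

end TraceClass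

namespace HilbertSchmidt

lemma hasSum_inner (X Y : HilbertSchmidt H) :
    HasSum (fun k => ⟪toCLM H X (onb H k), toCLM H Y (onb H k)⟫_ℂ) ⟪X, Y⟫_ℂ := by
  rw [show ⟪X, Y⟫_ℂ = ⟪toLp H X, toLp H Y⟫_ℂ from hsInner_eq_toLp X Y]
  exact lp.hasSum_inner (toLp H X) (toLp H Y)

lemma hasSum_norm_sq (X : HilbertSchmidt H) :
    HasSum (fun k => ‖toCLM H X (onb H k)‖ ^ 2) (‖X‖ ^ 2) := by
  have h := hasSum_inner X X
  simp only [inner_self_eq_norm_sq_to_K] at h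
  exact_mod_cast h

lemma toCLM_ketBra (u v z : H) :
    toCLM H (TraceClass.toHilbertSchmidt (ketBra u v)) z = ⟪v, z⟫_ℂ • u := rfl

lemma inner_ketBra (u v : H) (X : HilbertSchmidt H) :
    ⟪TraceClass.toHilbertSchmidt (ketBra u v), X⟫_ℂ = ⟪u, toCLM H X v⟫_ℂ := by
  have h := (innerSL ℂ u).hasSum ((toCLM H X).hasSum ((onb H).hasSum_repr v))
  simp only [HilbertBasis.repr_apply_apply, map_smul, innerSL_apply_apply, smul_eq_mul] at h
  refine (hasSum_inner _ X).unique (h.congr_fun fun k => ?_)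
  rw [toCLM_ketBra, inner_smul_left, inner_conj_symm]

lemma norm_ketBra (u v : H) : ‖TraceClass.toHilbertSchmidt (ketBra u v)‖ = ‖u‖ * ‖v‖ := by
  have h := inner_ketBra u v (TraceClass.toHilbertSchmidt (ketBra u v))
  simp only [toCLM_ketBra, inner_smul_right, inner_self_eq_norm_sq_to_K] at h
  refine (pow_left_inj₀ (norm_nonneg _) (by positivity) two_ne_zero).1 ?_
  rw [mul_pow, mul_comm]
  exact_mod_cast h

lemma ext_inner_self {X Y : HilbertSchmidt H}
    (h : ∀ u, ⟪u, toCLM H X u⟫_ℂ = ⟪u, toCLM H Y u⟫_ℂ) : X = Y := by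
  refine toCLM_injective (ContinuousLinearMap.coe_injective ?_)
  refine (ext_inner_map _ _).1 fun u => ?_
  simpa using congrArg (starRingEnd ℂ) (h u)

end HilbertSchmidt

/-! ### Complete positivity -/

section CompletePositivity

lemma inner_blockOp {E : Type*} [NormedAddCommGroup E] [InnerProductSpace ℂ E] {n : ℕ}
    (M : Matrix (Fin n) (Fin n) (E →L[ℂ] E)) (u v : PiLp 2 (fun _ : Fin n => E)) :
    ⟪u, blockOp M v⟫_ℂ = ∑ i, ∑ j, ⟪u i, M i j (v j)⟫_ℂ := by
  simp [blockOp, PiLp.inner_apply, inner_sum, sum_apply]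

lemma isPositive_blockOp_ketBra {n : ℕ} (x : Fin n → H) :
    (blockOp ((Matrix.of fun i j => ketBra (x i) (x j)).map
      fun a => (a : H →L[ℂ] H))).IsPositive := by
  refine isPositive_of_inner_nonneg fun z => ?_
  have hz : ⟪z, blockOp ((Matrix.of fun i j => ketBra (x i) (x j)).map
      fun a => (a : H →L[ℂ] H)) z⟫_ℂ = star (∑ i, ⟪x i, z i⟫_ℂ) * ∑ i, ⟪x i, z i⟫_ℂ := by
    rw [inner_blockOp, star_sum, Finset.sum_mul_sum]
    refine Finset.sum_congr rfl fun i _ => Finset.sum_congr rfl fun j _ => ?_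
    simp [mul_comm]
  rw [hz]
  exact star_mul_self_nonneg _

variable {Φ : TraceClass H →ₗ[ℂ] TraceClass H}

lemma CP.isPositive (hΦ : Φ ∈ CP H) {A : TraceClass H} (hA : (A : H →L[ℂ] H).IsPositive) :
    (Φ A : H →L[ℂ] H).IsPositive := by
  have hΦA := hΦ 1 (Matrix.of fun _ _ => A) (isPositive_of_inner_nonneg fun z => by
    simpa [inner_blockOp] using hA.inner_nonneg_right (z 0))
  refine isPositive_of_inner_nonneg fun z => ?_
  simpa [inner_blockOp] using hΦA.inner_nonneg_right (WithLp.toLp 2 fun _ => z)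

lemma CP.isPositiveFunctional_comp (hΦ : Φ ∈ CP H) {φ : TraceClass H →ₗ[ℂ] ℂ}
    (hφ : IsPositiveFunctional φ) : IsPositiveFunctional (φ ∘ₗ Φ) :=
  fun _ hA => hφ _ (CP.isPositive hΦ hA)

lemma CP.norm_sum_sum_inner_sq_le {ι : Type*} [Fintype ι] (hΦ : Φ ∈ CP H) (x u v : ι → H) :
    ‖∑ i, ∑ j, ⟪u i, (Φ (ketBra (x i) (x j)) : H →L[ℂ] H) (v j)⟫_ℂ‖ ^ 2 ≤
      (∑ i, ∑ j, ⟪u i, (Φ (ketBra (x i) (x j)) : H →L[ℂ] H) (u j)⟫_ℂ).re *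
        (∑ i, ∑ j, ⟪v i, (Φ (ketBra (x i) (x j)) : H →L[ℂ] H) (v j)⟫_ℂ).re := by
  let e := (Fintype.equivFin ι).symm
  have hT := hΦ _ _ (isPositive_blockOp_ketBra (x ∘ e))
  have hform : ∀ a b : ι → H, ⟪WithLp.toLp 2 (a ∘ e), blockOp
      ((Matrix.of fun i j => ketBra ((x ∘ e) i) ((x ∘ e) j)).map fun a => (Φ a : H →L[ℂ] H))
        (WithLp.toLp 2 (b ∘ e))⟫_ℂ =
      ∑ i, ∑ j, ⟪a i, (Φ (ketBra (x i) (x j)) : H →L[ℂ] H) (b j)⟫_ℂ := fun a b => by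
    rw [inner_blockOp, ← e.sum_comp]
    exact Finset.sum_congr rfl fun i _ => e.sum_comp
      fun j => ⟪a (e i), (Φ (ketBra (x (e i)) (x j)) : H →L[ℂ] H) (b j)⟫_ℂ
  simpa only [hform] using
    norm_inner_sq_le_of_isPositive hT (WithLp.toLp 2 (u ∘ e)) (WithLp.toLp 2 (v ∘ e))

lemma CP.norm_sum_inner_sq_le {ι : Type*} (hΦ : Φ ∈ CP H) (x u : ι → H) (w v : H)
    (F : Finset ι) :
    ‖∑ i ∈ F, ⟪u i, (Φ (ketBra (x i) w) : H →L[ℂ] H) v⟫_ℂ‖ ^ 2 ≤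
      (∑ p ∈ F ×ˢ F, ⟪u p.1, (Φ (ketBra (x p.1) (x p.2)) : H →L[ℂ] H) (u p.2)⟫_ℂ).re *
        (⟪v, (Φ (ketBra w w) : H →L[ℂ] H) v⟫_ℂ).re := by
  have h := CP.norm_sum_sum_inner_sq_le hΦ (fun o : Option F => o.elim w fun i => x i)
    (fun o => o.elim 0 fun i => u i) (fun o => o.elim v 0)
  simp only [Fintype.sum_option, Option.elim_none, Option.elim_some, Pi.zero_apply, map_zero,
    inner_zero_left, inner_zero_right, Finset.sum_const_zero, zero_add, add_zero] at h
  rw [Finset.sum_product]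
  simpa only [← Finset.sum_coe_sort F] using h

lemma CP.norm_inner_sq_le (hΦ : Φ ∈ CP H) (x y u v : H) :
    ‖⟪u, (Φ (ketBra x y) : H →L[ℂ] H) v⟫_ℂ‖ ^ 2 ≤
      (⟪u, (Φ (ketBra x x) : H →L[ℂ] H) u⟫_ℂ).re * (⟪v, (Φ (ketBra y y) : H →L[ℂ] H) v⟫_ℂ).re := by
  simpa using CP.norm_sum_inner_sq_le hΦ (fun _ => x) (fun _ => u) y v {()}

lemma CP.norm_toHilbertSchmidt_sq_le (hΦ : Φ ∈ CP H) (x y : H) :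
    ‖TraceClass.toHilbertSchmidt (Φ (ketBra x y))‖ ^ 2 ≤
      (traceFunctional H (Φ (ketBra x x))).re * (traceFunctional H (Φ (ketBra y y))).re := by
  have hx := Complex.hasSum_re (TraceClass.hasSum_inner_onb (Φ (ketBra x x)))
  have hy := Complex.hasSum_re (TraceClass.hasSum_inner_onb (Φ (ketBra y y)))
  refine hasSum_le (fun k => ?_) (HilbertSchmidt.hasSum_norm_sq _) (hy.mul_left _)
  exact hasSum_le (fun i => CP.norm_inner_sq_le hΦ x y (onb H i) (onb H k))
    (hasSum_norm_inner_onb_sq _) (hx.mul_right _)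

end CompletePositivity

/-! ### The trace of `Φ(B* (·) B)` -/

section Weighted

variable {ι : Type*} {Φ : TraceClass H →ₗ[ℂ] TraceClass H} {B : TraceClass H} {x y : ι → H}

lemma CP.summable_norm_mul_sqrt_trace (hΦ : Φ ∈ CP H) (hx : Summable fun n => ‖x n‖ ^ 2)
    (hy : Summable fun n => ‖y n‖ ^ 2) :
    Summable fun n => ‖x n‖ * √(traceFunctional H (Φ (ketBra (y n) (y n)))).re := by
  have hpos := CP.isPositiveFunctional_comp hΦ (isPositiveFunctional_traceFunctional (H := H))
  obtain ⟨P, hP⟩ := exists_hasNuclearSum (summable_mul_of_summable_sq hy hy)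
  refine summable_mul_of_summable_sq hx ?_
  have hφP := hP.hasSum_of_isPositiveFunctional_self hpos
  refine (Complex.hasSum_re hφP).summable.congr fun n => ?_
  exact (Real.sq_sqrt (hpos.re_nonneg (isPositive_ketBra_self (y n)))).symm

lemma CP.summable_norm_toHilbertSchmidt_mul_norm (hΦ : Φ ∈ CP H)
    (hx : Summable fun n => ‖x n‖ ^ 2) (hy : Summable fun n => ‖y n‖ ^ 2) :
    Summable fun p : ι × ι => ‖TraceClass.toHilbertSchmidt (Φ (ketBra (y p.1) (y p.2)))‖ *
      ‖TraceClass.toHilbertSchmidt (ketBra (x p.1) (x p.2))‖ := by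
  set τ : ι → ℝ := fun n => (traceFunctional H (Φ (ketBra (y n) (y n)))).re
  have hτ : Summable fun n => ‖x n‖ * √(τ n) := CP.summable_norm_mul_sqrt_trace hΦ hx hy
  refine (hτ.mul_of_nonneg hτ (fun _ => by positivity) fun _ => by positivity).of_nonneg_of_le
    (fun p => by positivity) fun p => ?_
  have hτ0 : 0 ≤ τ p.1 := isPositiveFunctional_traceFunctional.re_nonneg
    (CP.isPositive hΦ (isPositive_ketBra_self _))
  have hle : ‖TraceClass.toHilbertSchmidt (Φ (ketBra (y p.1) (y p.2)))‖ ≤ √(τ p.1) * √(τ p.2) := by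
    rw [← Real.sqrt_mul hτ0]
    exact Real.le_sqrt_of_sq_le (CP.norm_toHilbertSchmidt_sq_le hΦ _ _)
  rw [HilbertSchmidt.norm_ketBra]
  calc ‖TraceClass.toHilbertSchmidt (Φ (ketBra (y p.1) (y p.2)))‖ * (‖x p.1‖ * ‖x p.2‖)
      ≤ √(τ p.1) * √(τ p.2) * (‖x p.1‖ * ‖x p.2‖) := by gcongr
    _ = ‖x p.1‖ * √(τ p.1) * (‖x p.2‖ * √(τ p.2)) := by ring

lemma CP.hasSum_weighted (hΦ : Φ ∈ CP H) (hB : HasNuclearSum (B : H →L[ℂ] H) x y)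
    (hx : Summable fun n => ‖x n‖ ^ 2) (hy : Summable fun n => ‖y n‖ ^ 2)
    (X : HilbertSchmidt H) :
    HasSum (fun p : ι × ι => ⟪TraceClass.toHilbertSchmidt (ketBra (x p.1) (x p.2)), X⟫_ℂ •
      TraceClass.toHilbertSchmidt (Φ (ketBra (y p.1) (y p.2)))) (weighted Φ B X) := by
  have hsummable : Summable fun p : ι × ι =>
      ⟪TraceClass.toHilbertSchmidt (ketBra (x p.1) (x p.2)), X⟫_ℂ •
        TraceClass.toHilbertSchmidt (Φ (ketBra (y p.1) (y p.2))) := by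
    refine ((CP.summable_norm_toHilbertSchmidt_mul_norm hΦ hx hy).mul_right ‖X‖).of_norm_bounded
      fun p => ?_
    rw [norm_smul, mul_comm, mul_assoc]
    gcongr
    exact norm_inner_le_norm _ _
  obtain ⟨W, hW⟩ := hsummable
  suffices W = weighted Φ B X by rwa [← this]
  refine HilbertSchmidt.ext_inner_self fun u => ?_
  have hWu := (innerSL ℂ (TraceClass.toHilbertSchmidt (ketBra u u))).hasSum hW
  have hsandwich : HasNuclearSum (sandwich B X : H →L[ℂ] H)
      (fun p : ι × ι => ⟪x p.1, HilbertSchmidt.toCLM H X (x p.2)⟫_ℂ • y p.1) (fun p => y p.2) :=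
    hB.adjoint.comp_clm_comp hB (HilbertSchmidt.toCLM H X)
  have hnormal := hsandwich.hasSum_of_isPositiveFunctional
    (CP.isPositiveFunctional_comp hΦ (isPositiveFunctional_vectorFunctional u))
  simp only [innerSL_apply_apply, HilbertSchmidt.inner_ketBra] at hWu
  refine hWu.unique (hnormal.congr_fun fun p => ?_)
  rw [ketBra_smul_left, map_smul, map_smul, smul_apply, inner_smul_right]
  rfl

lemma CP.hasSum_trace_weighted (hΦ : Φ ∈ CP H) (hB : HasNuclearSum (B : H →L[ℂ] H) x y)
    (hx : Summable fun n => ‖x n‖ ^ 2) (hy : Summable fun n => ‖y n‖ ^ 2) :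
    HasSum (fun p : ι × ι => ⟪x p.1, (Φ (ketBra (y p.1) (y p.2)) : H →L[ℂ] H) (x p.2)⟫_ℂ)
      (trace (weighted Φ B)) := by
  refine (hasSum_trace (CP.summable_norm_toHilbertSchmidt_mul_norm hΦ hx hy)
    (CP.hasSum_weighted hΦ hB hx hy)).congr_fun fun p => ?_
  rw [HilbertSchmidt.inner_ketBra]
  rfl

lemma CPWeighted.hasSum_inner_zero (hΦ : Φ ∈ CPWeighted B)
    (hB : HasNuclearSum (B : H →L[ℂ] H) x y) (hx : Summable fun n => ‖x n‖ ^ 2)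
    (hy : Summable fun n => ‖y n‖ ^ 2) (w v : H) :
    HasSum (fun n => ⟪x n, (Φ (ketBra (y n) w) : H →L[ℂ] H) v⟫_ℂ) 0 := by
  have htrace := CP.hasSum_trace_weighted hΦ.1 hB hx hy
  rw [hΦ.2] at htrace
  have hsquare : Tendsto (fun F : Finset ι => F ×ˢ F) atTop atTop :=
    tendsto_finsetProd_atTop.comp tendsto_atTop_diagonal
  have hdiag := ((Complex.continuous_re.tendsto _).comp (htrace.comp hsquare)).mul_const
    (⟪v, (Φ (ketBra w w) : H →L[ℂ] H) v⟫_ℂ).re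
  rw [Complex.zero_re, zero_mul] at hdiag
  have hsq := (squeeze_zero (fun _ => by positivity)
    (CP.norm_sum_inner_sq_le hΦ.1 y x w v) hdiag).sqrt
  simp only [Real.sqrt_sq (norm_nonneg _), Real.sqrt_zero] at hsq
  exact tendsto_zero_iff_norm_tendsto_zero.2 hsq

end Weighted

/-! ### Perturbations of the form `K A + A K*` -/

section LeftRight

lemma leftRight_ketBra (K : H →L[ℂ] H) (x y : H) :
    leftRight K (ketBra x y) = ketBra (K x) y + ketBra x (K y) := by
  ext z
  simp [leftRight, ContinuousLinearMap.adjoint_inner_right]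

lemma CPWeighted.trace_mul_inner_add_eq_zero {K : H →L[ℂ] H} {B : TraceClass H}
    {Φ₁ Φ₂ : TraceClass H →ₗ[ℂ] TraceClass H} (hΦ₁ : Φ₁ ∈ CPWeighted B) (hΦ₂ : Φ₂ ∈ CPWeighted B)
    (hK : leftRight K = Φ₁ - Φ₂) (w v : H) :
    trace ((ContinuousLinearMap.adjoint (B : H →L[ℂ] H) ∘L K : H →L[ℂ] H) : H →ₗ[ℂ] H) * ⟪w, v⟫_ℂ +
      star (trace ((B : H →L[ℂ] H) : H →ₗ[ℂ] H)) * ⟪K w, v⟫_ℂ = 0 := by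
  obtain ⟨_, _, _, hnuc⟩ := B.2.exists_nuclear
  obtain ⟨x, y, -, hB, hx, hy⟩ := hnuc.exists_summable_norm_sq
  have hzero := (CPWeighted.hasSum_inner_zero hΦ₁ hB hx hy w v).sub
    (CPWeighted.hasSum_inner_zero hΦ₂ hB hx hy w v)
  have hBid := hB.hasSum_trace_adjoint_comp (ContinuousLinearMap.id ℂ H)
  rw [ContinuousLinearMap.comp_id, trace_adjoint] at hBid
  have hsum := ((hB.hasSum_trace_adjoint_comp K).mul_right ⟪w, v⟫_ℂ).add
    (hBid.mul_right ⟪K w, v⟫_ℂ)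
  rw [sub_zero] at hzero
  refine hsum.unique (hzero.congr_fun fun n => ?_)
  rw [← inner_sub_right]
  have hn := congrArg (fun Ψ : TraceClass H →ₗ[ℂ] TraceClass H =>
    (Ψ (ketBra (y n) w) : H →L[ℂ] H) v) hK
  rw [leftRight_ketBra] at hn
  simp only [LinearMap.sub_apply, AddSubgroupClass.coe_sub, Submodule.coe_add, sub_apply,
    add_apply, coe_ketBra, InnerProductSpace.rankOne_apply] at hn
  rw [← hn]
  simp [inner_add_right, inner_smul_right, mul_comm]

lemma exists_eq_smul_id_of_mul_inner_add_eq_zero {E : Type*} [NormedAddCommGroup E]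
    [InnerProductSpace ℂ E] {K : E →L[ℂ] E} {α β : ℂ} (hβ : β ≠ 0)
    (h : ∀ w v, α * ⟪w, v⟫_ℂ + β * ⟪K w, v⟫_ℂ = 0) :
    ∃ c : ℂ, α = -star c * β ∧ K = c • ContinuousLinearMap.id ℂ E := by
  refine ⟨-star (α / β), by simp [hβ], ?_⟩
  ext w
  refine ext_inner_right ℂ fun v => ?_
  have hKw : ⟪K w, v⟫_ℂ = -(α / β) * ⟪w, v⟫_ℂ := by
    field_simp
    linear_combination h w v
  simp [hKw, inner_smul_left]

end LeftRight

end QDyn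

end

theorem proposition2_general {H : Type*} [NormedAddCommGroup H] [InnerProductSpace ℂ H]
    [CompleteSpace H] (K : H →L[ℂ] H) (B : QDyn.TraceClass H)
    (hB : QDyn.trace ((B : H →L[ℂ] H) : H →ₗ[ℂ] H) ≠ 0)
    (hK : ∃ Φ₁ ∈ QDyn.CPWeighted B, ∃ Φ₂ ∈ QDyn.CPWeighted B, QDyn.leftRight K = Φ₁ - Φ₂) :
    ∃ l : ℝ, K = (Complex.I * (l : ℂ)) • ContinuousLinearMap.id ℂ H := by
  obtain ⟨Φ₁, hΦ₁, Φ₂, hΦ₂, hK⟩ := hK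
  have hβ := star_ne_zero.2 hB
  obtain ⟨c, hα, rfl⟩ := QDyn.exists_eq_smul_id_of_mul_inner_add_eq_zero hβ
    (QDyn.CPWeighted.trace_mul_inner_add_eq_zero hΦ₁ hΦ₂ hK)
  rw [ContinuousLinearMap.comp_smul, ContinuousLinearMap.comp_id,
    ContinuousLinearMap.toLinearMap_smul, QDyn.trace_smul, QDyn.trace_adjoint] at hα
  have hc : c = -star c := mul_right_cancel₀ hβ hα
  have hre : c.re = 0 := self_eq_neg.1 (congrArg Complex.re hc)
  exact ⟨c.im, congrArg (· • _) (Complex.ext (by simp [hre]) (by simp))⟩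

theorem proposition2 {H : Type*} [NormedAddCommGroup H] [InnerProductSpace ℂ H] [CompleteSpace H]
    [TopologicalSpace.SeparableSpace H] (K : H →L[ℂ] H) (B : QDyn.TraceClass H)
    (hB : QDyn.trace ((B : H →L[ℂ] H) : H →ₗ[ℂ] H) ≠ 0)
    (hK : ∃ Φ₁ ∈ QDyn.CPWeighted B, ∃ Φ₂ ∈ QDyn.CPWeighted B, QDyn.leftRight K = Φ₁ - Φ₂) :
    ∃ l : ℝ, K = (Complex.I * (l : ℂ)) • ContinuousLinearMap.id ℂ H :=
  proposition2_general K B hB hK
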